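/- All Hilbert spaces are complex. Let $X$ be a set. A kernel on $X$ is a function $k:X\times X\to\mathbb C$ such that the matrix $[k(x,y)]_{x,y\in S}$ is positive semi-definite for every finite $S\subset X$. For a Hilbert space $\mathcal E$, $\mathcal H_k\otimes\mathcal E$ denotes the reproducing kernel Hilbert space of $\mathcal E$-valued functions on $X$ with the $\mathcal B(\mathcal E)$-valued kernel $k\,I_{\mathcal E}$. For kernels $\ell,k$ on $X$ and Hilbert spaces $\mathcal F,\mathcal E$, $\mathrm{Mult}(\mathcal H_\ell\otimes\mathcal F,\mathcal H_k\otimes\mathcal E)$ is the set of functions $\Phi:X\to\mathcal B(\mathcal F,\mathcal E)$ such that $\Phi\cdot f:x\mapsto\Phi(x)f(x)$ belongs to $\mathcal H_k\otimes\mathcal E$ for every $f\in\mathcal H_\ell\otimes\mathcal F$. Such a $\Phi$ is called contractive (partially isometric) if the operator $M_\Phi: \mathcal H_\ell\otimes\mathcal F\to\mathcal H_k\otimes\mathcal E$, $f\mapsto\Phi\cdot f$, is a contraction (a partial isometry). A kernel $s$ on $X$ is normalized if there is $x_0\in X$ with $s(x,x_0)=1$ for all $x\in X$. It is a complete Nevanlinna–Pick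 kernel if for all $m,n\in\mathbb N$, all finite $S\subset X$ and all $W:S\to\mathcal B(\mathbb C^n,\mathbb C^m)$ such that the block matrix $[s(z,w)(I-W(z)W(w)^*)]_{z,w\in S}$ is positive semi-definite, there is a contractive multiplier $\Phi\in\mathrm{Mult}(\mathcal H_s\otimes\mathbb C^n,\mathcal H_s\otimes\mathbb C^m)$ with $\Phi(z)=W(z)$ for all $z\in S$. **Theorem.** Let $k,\ell$ be kernels on $X$ and let $s$ be a normalized complete Nevanlinna–Pick kernel on $X$. Let $\mathcal E$ be a Hilbert space and let $\mathcal M\subset\mathcal H_k\otimes\mathcal E$ and $\mathcal N\subset\mathcal H_\ell\otimes\mathcal E$ be non-zero closed subspaces such that $\mathcal N$ is contractively contained in $\mathcal M$, that is, $\mathcal N\subset\mathcal M$ as sets of functions and $\|f\|_{\mathcal H_k\otimes\mathcal E}\le\|f\|_{\mathcal H_\ell\otimes\mathcal E}$ for all $f\in\mathcal N$. If $\mathcal F,\mathcal G$ are Hilbert spaces and $\Phi\in\mathrm{Mult}(\mathcal H_s\otimes\mathcal F,\mathcal H_k\otimes\mathcal E)$ and $\Psi\in\mathrm{Mult}(\mathcal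 H_s\otimes\mathcal G,\mathcal H_\ell\otimes\mathcal E)$ are partially isometric multipliers with $\mathcal M=\Phi\cdot(\mathcal H_s\otimes\mathcal F)$ and $\mathcal N=\Psi\cdot(\mathcal H_s\otimes\mathcal G)$, then there exists a contractive multiplier $\Gamma\in\mathrm{Mult}(\mathcal H_s\otimes\mathcal G,\mathcal H_s\otimes\mathcal F)$ with $\Psi(x)=\Phi(x)\Gamma(x)$ for all $x\in X$. -/

import Mathlib

noncomputable section

namespace BeurlingLaxHalmos

open scoped ComplexOrder InnerProduct

universe u v w

/-- A (scalar-valued) kernel on `X`: a function `k : X × X → ℂ` such that the matrix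
`[k(x, y)]` with `x, y ∈ S` is positive semi-definite for every finite subset `S` of `X`. -/
structure ScalarKernel (X : Type u) where
  /-- the underlying function of two variables -/
  toFun : X → X → ℂ
  posSemidef : ∀ S : Finset X, (Matrix.of fun x y : S => toFun x y).PosSemidef

instance {X : Type u} : CoeFun (ScalarKernel X) (fun _ => X → X → ℂ) := ⟨ScalarKernel.toFun⟩

/-- The `B(E)`-valued function `(x, y) ↦ k(x, y) I_E`. -/
def ScalarKernel.ampliation {X : Type u} (k : ScalarKernel X) (E : Type v)
    [NormedAddCommGroup E] [InnerProductSpace ℂ E] : Matrix X X (E →L[ℂ] E) :=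
  Matrix.of fun x y => k x y • ContinuousLinearMap.id ℂ E

theorem ScalarKernel.conj_apply {X : Type u} (k : ScalarKernel X) (x y : X) :
    star (k y x) = k x y := by
  classical
  have h := (k.posSemidef {x, y}).isHermitian.apply ⟨x, by simp⟩ ⟨y, by simp⟩
  simpa using h

theorem ScalarKernel.posSemidef_ampliation {X : Type u} (k : ScalarKernel X) (E : Type v)
    [NormedAddCommGroup E] [InnerProductSpace ℂ E] [CompleteSpace E] :
    (k.ampliation E).PosSemidef := by
  classical
  have htfae := (RKHS.posSemidef_tfae (K := k.ampliation E)).out 0 2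
  refine htfae.mpr ⟨?_, fun f => ?_⟩
  · ext1 x y
    change star (k y x • ContinuousLinearMap.id ℂ E) = k x y • ContinuousLinearMap.id ℂ E
    rw [star_smul, k.conj_apply]
    congr 1
    exact star_one (E →L[ℂ] E)
  · have h := ((k.posSemidef f.support).hadamard
      (Matrix.posSemidef_gram (𝕜 := ℂ) (fun x : f.support => f x))).dotProduct_mulVec_nonneg 1
    have h2 : (star (1 : f.support → ℂ)) ⬝ᵥ
        ((Matrix.of fun x y : f.support => k x y).hadamard
          (Matrix.gram ℂ (fun x : f.support => f x))).mulVec 1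
        = f.sum fun x w => f.sum fun x' w' => inner ℂ (k.ampliation E x' x w) w' := by
      simp only [dotProduct, Matrix.mulVec, Finsupp.sum, Pi.star_apply, Pi.one_apply, star_one,
        one_mul, mul_one, Matrix.hadamard_apply, Matrix.of_apply, Matrix.gram_apply]
      rw [← Finset.sum_coe_sort f.support]
      refine Finset.sum_congr rfl fun x _ => ?_
      rw [← Finset.sum_coe_sort f.support]
      refine Finset.sum_congr rfl fun y _ => ?_
      simp only [ScalarKernel.ampliation, Matrix.of_apply, _root_.smul_apply,
        ContinuousLinearMap.id_apply, inner_smul_left]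
      rw [← k.conj_apply x y]
      rfl
    rw [h2] at h
    exact (Complex.le_def.mp h).1

instance {X : Type u} (k : ScalarKernel X) (E : Type v)
    [NormedAddCommGroup E] [InnerProductSpace ℂ E] [CompleteSpace E] :
    Fact (k.ampliation E).PosSemidef := ⟨k.posSemidef_ampliation E⟩

/-- The Hilbert space `H_k ⊗ E`, regarded as a space of `E`-valued functions on `X`:
the reproducing kernel Hilbert space on `X` of the `B(E)`-valued kernel `k I_E`.
Its elements `f` are evaluated at points as `f x`. -/
abbrev HTensor {X : Type u} (k : ScalarKernel X) (E : Type v)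
    [NormedAddCommGroup E] [InnerProductSpace ℂ E] [CompleteSpace E] : Type (max u v) :=
  RKHS.OfKernel (k.ampliation E)

section Multipliers

variable {X : Type u} {F : Type v} {E : Type w}
  [NormedAddCommGroup F] [InnerProductSpace ℂ F] [CompleteSpace F]
  [NormedAddCommGroup E] [InnerProductSpace ℂ E] [CompleteSpace E]

/-- `Φ ∈ Mult(H_ℓ ⊗ F, H_k ⊗ E)`: the `B(F, E)`-valued function `Φ` on `X` multiplies
`H_ℓ ⊗ F` into `H_k ⊗ E`. -/
def IsMultiplier (l k : ScalarKernel X) (Φ : X → F →L[ℂ] E) : Prop :=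
  ∀ f : HTensor l F, ∃ g : HTensor k E, ∀ x, g x = Φ x (f x)

/-- The multiplication map of a multiplier, as a linear map. -/
def IsMultiplier.mulLinear {l k : ScalarKernel X} {Φ : X → F →L[ℂ] E}
    (h : IsMultiplier l k Φ) : HTensor l F →ₗ[ℂ] HTensor k E where
  toFun f := (h f).choose
  map_add' f g := by
    ext x
    rw [(h (f + g)).choose_spec x]
    simp [(h f).choose_spec x, (h g).choose_spec x]
  map_smul' c f := by
    ext x
    rw [(h (c • f)).choose_spec x]
    simp [(h f).choose_spec x]

theorem IsMultiplier.mulLinear_apply {l k : ScalarKernel X} {Φ : X → F →L[ℂ] E}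
    (h : IsMultiplier l k Φ) (f : HTensor l F) (x : X) : h.mulLinear f x = Φ x (f x) :=
  (h f).choose_spec x

theorem IsMultiplier.isClosed_graph {l k : ScalarKernel X} {Φ : X → F →L[ℂ] E}
    (h : IsMultiplier l k Φ) :
    IsClosed (h.mulLinear.graph : Set (HTensor l F × HTensor k E)) := by
  have : (h.mulLinear.graph : Set (HTensor l F × HTensor k E)) =
      ⋂ x : X, {p | p.2 x = Φ x (p.1 x)} := by
    ext p
    simp only [SetLike.mem_coe, LinearMap.mem_graph_iff, Set.mem_iInter,
      Set.mem_ofPred_eq]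
    constructor
    · intro hp x
      rw [hp, h.mulLinear_apply]
    · intro hp
      ext x
      rw [hp x, h.mulLinear_apply]
  rw [this]
  refine isClosed_iInter fun x => isClosed_eq ?_ ?_
  · exact (RKHS.continuous_eval x).comp continuous_snd
  · exact (Φ x).continuous.comp ((RKHS.continuous_eval x).comp continuous_fst)

/-- The multiplication operator `M_Φ : H_ℓ ⊗ F → H_k ⊗ E`, `f ↦ Φ · f`; it is bounded by the
closed graph theorem. -/
def IsMultiplier.mulOp {l k : ScalarKernel X} {Φ : X → F →L[ℂ] E}
    (h : IsMultiplier l k Φ) : HTensor l F →L[ℂ] HTensor k E :=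
  ContinuousLinearMap.ofIsClosedGraph h.isClosed_graph

theorem IsMultiplier.mulOp_apply {l k : ScalarKernel X} {Φ : X → F →L[ℂ] E}
    (h : IsMultiplier l k Φ) (f : HTensor l F) (x : X) : h.mulOp f x = Φ x (f x) :=
  h.mulLinear_apply f x

/-- `Φ` is a multiplier whose multiplication operator is a contraction. -/
def IsContractiveMultiplier (l k : ScalarKernel X) (Φ : X → F →L[ℂ] E) : Prop :=
  ∃ h : IsMultiplier l k Φ, ‖h.mulOp‖ ≤ 1

/-- `Φ` is a multiplier whose multiplication operator is a partial isometry, i.e. it is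
isometric on the orthogonal complement of its null space. -/
def IsPartiallyIsometricMultiplier (l k : ScalarKernel X) (Φ : X → F →L[ℂ] E) : Prop :=
  ∃ h : IsMultiplier l k Φ, ∀ f ∈ (LinearMap.ker h.mulOp.toLinearMap)ᗮ, ‖h.mulOp f‖ = ‖f‖

/-- The set `Φ · (H_ℓ ⊗ F)` of all functions `x ↦ Φ(x) f(x)`, `f ∈ H_ℓ ⊗ F`, as a subset of
`H_k ⊗ E`. -/
def mulImage (l k : ScalarKernel X) (Φ : X → F →L[ℂ] E) : Set (HTensor k E) :=
  {g | ∃ f : HTensor l F, ∀ x, g x = Φ x (f x)}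

end Multipliers

/-- The kernel `k` is normalized (at some point of `X`). -/
def ScalarKernel.IsNormalized {X : Type u} (k : ScalarKernel X) : Prop :=
  ∃ x₀ : X, ∀ x : X, k x x₀ = 1

/-- `s` is a complete Nevanlinna–Pick kernel: matrix-valued Nevanlinna–Pick interpolation
problems of all sizes `m × n` are governed by the Pick matrix. That is, whenever
`W : S → M_{m,n}(ℂ)` is a function on a finite subset `S` of `X` for which the block matrix
`[s(z, w) (I - W(z) W(w)^*)]` with `z, w ∈ S` is positive semi-definite, there is a contractive
multiplier `Φ` from `H_s ⊗ ℂⁿ` to `H_s ⊗ ℂᵐ` with `Φ(z) = W(z)` for all `z ∈ S`. -/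
def ScalarKernel.IsCompleteNevanlinnaPick {X : Type u} (s : ScalarKernel X) : Prop :=
  ∀ (m n : ℕ) (S : Finset X)
    (W : S → EuclideanSpace ℂ (Fin n) →L[ℂ] EuclideanSpace ℂ (Fin m)),
    (Matrix.of fun z w : S =>
      s z w • (ContinuousLinearMap.id ℂ (EuclideanSpace ℂ (Fin m)) - W z ∘L (W w)†)).PosSemidef →
    ∃ Φ : X → EuclideanSpace ℂ (Fin n) →L[ℂ] EuclideanSpace ℂ (Fin m),
      IsContractiveMultiplier s s Φ ∧ ∀ z : S, Φ z = W z

/-- The subspace `N ⊂ H_ℓ ⊗ E` is contractively contained in `M ⊂ H_k ⊗ E`: every function in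
`N` belongs to `M`, and its norm in `M` is at most its norm in `N`. -/
def IsContractivelyContained {X : Type u} {E : Type w}
    [NormedAddCommGroup E] [InnerProductSpace ℂ E] [CompleteSpace E] {l k : ScalarKernel X}
    (N : Submodule ℂ (HTensor l E)) (M : Submodule ℂ (HTensor k E)) : Prop :=
  ∀ f ∈ N, ∃ g ∈ M, (∀ x, g x = f x) ∧ ‖g‖ ≤ ‖f‖

end BeurlingLaxHalmos

end

/-!
Write `K ≥ 0` for positive semidefiniteness of a kernel. The ranges `M` and `N` of the partially
isometric multipliers have the kernels `s(x, y) Φ(x) Φ(y)^*` and `s(x, y) Ψ(x) Ψ(y)^*`, so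
contractive containment of `N` in `M` gives `s(x, y) (Φ(x) Φ(y)^* - Ψ(x) Ψ(y)^*) ≥ 0`
(`posSemidef_gram_sub_gram_of_isContractivelyContained`). It remains to solve `Ψ = Φ Γ` with
`s(x, y) (1 - Γ(x) Γ(y)^*) ≥ 0`, which is Leech's factorization theorem over `s`.

The Nevanlinna–Pick property enters through the McCullough–Quiggin theorem: `t = 1 - 1 / s` is a
kernel (`ScalarKernel.IsCompleteNevanlinnaPick.oneSubInv`). An interpolating contractive multiplier
maps functions vanishing at `y` to functions vanishing at `y`, so the Pick matrix of solvable
data remains positive semidefinite after passing to the kernel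
`s(z, w) - s(z, y) s(y, w) / s(y, y)`. Applied to suitable row-valued data, this gives
`1 - s(z, y) s(y, w) / (s(z, w) s(y, y)) ≥ 0` by induction on the number of points.

With `s (Φ Φ^* - Ψ Ψ^*) = L L^*`, multiplication by `1 / s = 1 - t` turns the hypothesis into
`Φ Φ^* + t L L^* = Ψ Ψ^* + L L^*`, the lurking isometry identity, and `Γ^*` is the transfer
function of the resulting contraction (`exists_contractiveMultiplier_factor`). Here `L` takes values
in the reproducing kernel Hilbert space of the left-hand kernel, and the kernel functions of
`HTensor t _` provide the factorization of `t L L^*`, so that no Hilbert space tensor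
product is needed.

Positivity of operator-valued kernels is phrased as `gram v - gram w` being positive semidefinite
for families of vectors indexed by `X × E`, which amounts to the existence of a contraction
`v i ↦ w i` (`exists_contraction_of_gram_le`).
-/

namespace BeurlingLaxHalmos

open Matrix
open scoped ComplexOrder InnerProductSpace

/-! ### Gram matrices and contractions -/

section GramMatrices

variable {ι H H' : Type*} [NormedAddCommGroup H] [InnerProductSpace ℂ H]
  [NormedAddCommGroup H'] [InnerProductSpace ℂ H']

theorem sum_gram_eq_inner_linearCombination (v : ι → H) (c : ι →₀ ℂ) :
    (c.sum fun i a => c.sum fun j b => star a * gram ℂ v i j * b) =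
      ⟪Finsupp.linearCombination ℂ v c, Finsupp.linearCombination ℂ v c⟫_ℂ := by
  simp only [Finsupp.linearCombination_apply, Finsupp.sum, sum_inner, inner_sum, inner_smul_left,
    inner_smul_right, gram_apply, Finset.mul_sum]
  refine (Finset.sum_comm.trans ?_)
  refine Finset.sum_congr rfl fun i _ => Finset.sum_congr rfl fun j _ => ?_
  simp only [RCLike.star_def]
  ring

/-- Gram matrices over an arbitrary, possibly infinite, index type are positive semidefinite. -/
theorem posSemidef_gram_infinite (v : ι → H) : (gram ℂ v).PosSemidef := by
  refine ⟨isHermitian_gram ℂ v, fun c => ?_⟩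
  rw [sum_gram_eq_inner_linearCombination, inner_self_eq_norm_sq_to_K,
    ← RCLike.ofReal_pow]
  exact RCLike.ofReal_nonneg.2 (sq_nonneg _)

theorem norm_linearCombination_le_of_posSemidef {v : ι → H} {w : ι → H'}
    (h : (gram ℂ v - gram ℂ w).PosSemidef) (c : ι →₀ ℂ) :
    ‖Finsupp.linearCombination ℂ w c‖ ≤ ‖Finsupp.linearCombination ℂ v c‖ := by
  have h1 := h.2 c
  simp only [Matrix.sub_apply, mul_sub, sub_mul, Finsupp.sum_sub] at h1
  rw [sum_gram_eq_inner_linearCombination, sum_gram_eq_inner_linearCombination,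
    inner_self_eq_norm_sq_to_K, inner_self_eq_norm_sq_to_K, sub_nonneg] at h1
  have h2 : ‖Finsupp.linearCombination ℂ w c‖ ^ 2 ≤ ‖Finsupp.linearCombination ℂ v c‖ ^ 2 := by
    exact_mod_cast h1
  exact (sq_le_sq₀ (norm_nonneg _) (norm_nonneg _)).1 h2

theorem posSemidef_gram_sub_gram_of_norm_le {v : ι → H} {w : ι → H'}
    (h : ∀ c : ι →₀ ℂ,
      ‖Finsupp.linearCombination ℂ w c‖ ≤ ‖Finsupp.linearCombination ℂ v c‖) :
    (gram ℂ v - gram ℂ w).PosSemidef := by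
  refine ⟨(isHermitian_gram ℂ v).sub (isHermitian_gram ℂ w), fun c => ?_⟩
  simp only [Matrix.sub_apply, mul_sub, sub_mul, Finsupp.sum_sub]
  rw [sum_gram_eq_inner_linearCombination, sum_gram_eq_inner_linearCombination,
    inner_self_eq_norm_sq_to_K, inner_self_eq_norm_sq_to_K, sub_nonneg,
    ← RCLike.ofReal_pow, ← RCLike.ofReal_pow, RCLike.ofReal_le_ofReal]
  gcongr
  exact h c

/-- Contractions are what transports one family of vectors to another one with a smaller Gram
matrix: the map is defined on the closed span of the first family and extended by zero on its
orthogonal complement. -/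
theorem exists_contraction_of_gram_le [CompleteSpace H] [CompleteSpace H']
    {v : ι → H} {w : ι → H'}
    (h : (gram ℂ v - gram ℂ w).PosSemidef) :
    ∃ T : H →L[ℂ] H', ‖T‖ ≤ 1 ∧ ∀ i, T (v i) = w i := by
  set K : Submodule ℂ H := (LinearMap.range (Finsupp.linearCombination ℂ v)).topologicalClosure
  have hle : LinearMap.range (Finsupp.linearCombination ℂ v) ≤ K :=
    Submodule.le_topologicalClosure _
  let e : (ι →₀ ℂ) →ₗ[ℂ] K := (Finsupp.linearCombination ℂ v).codRestrict K
    fun c => hle (LinearMap.mem_range_self _ c)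
  have hdense : DenseRange e := by
    intro x
    have hx : (x : H) ∈ closure (Set.range (Finsupp.linearCombination ℂ v)) := x.2
    rw [closure_subtype]
    convert hx
    ext y
    constructor
    · rintro ⟨_, ⟨c, rfl⟩, rfl⟩
      exact ⟨c, rfl⟩
    · rintro ⟨c, rfl⟩
      exact ⟨e c, ⟨c, rfl⟩, rfl⟩
  have hnorm : ∀ c, ‖Finsupp.linearCombination ℂ w c‖ ≤ 1 * ‖e c‖ := fun c => by
    rw [one_mul]
    exact norm_linearCombination_le_of_posSemidef h c
  have : CompleteSpace K := (Submodule.isClosed_topologicalClosure _).completeSpace_coe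
  refine ⟨(Finsupp.linearCombination ℂ w).extendOfNorm e ∘L K.orthogonalProjectionOnto, ?_,
    fun i => ?_⟩
  · refine ContinuousLinearMap.opNorm_le_bound _ zero_le_one fun x => ?_
    refine (LinearMap.norm_extendOfNorm_apply_le hdense 1 hnorm _).trans ?_
    gcongr
    exact K.norm_orthogonalProjectionOnto_apply_le x
  · have hv : v i = (e (Finsupp.single i 1) : H) := by simp [e]
    rw [ContinuousLinearMap.comp_apply, hv, Submodule.orthogonalProjectionOnto_mem_subspace_eq_self,
      LinearMap.extendOfNorm_eq hdense ⟨1, hnorm⟩]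
    simp

/-- Version of `Matrix.posSemidef_opNorm_smul_gram_sub_gram` for contractions. -/
theorem posSemidef_gram_sub_gram_of_contraction (v : ι → H) {T : H →L[ℂ] H'} (hT : ‖T‖ ≤ 1) :
    (gram ℂ v - gram ℂ fun i => T (v i)).PosSemidef := by
  have h1 := posSemidef_opNorm_smul_gram_sub_gram (𝕜 := ℂ) v T
  have h2 : ((1 - ‖T‖ ^ 2 : ℝ) • gram ℂ v).PosSemidef := by
    refine (posSemidef_gram_infinite v).smul ?_
    have := pow_le_one₀ (n := 2) (norm_nonneg T) hT
    linarith
  have h3 := h2.add h1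
  convert h3 using 1
  rw [sub_smul, one_smul]
  simp only [sub_add_sub_cancel]
  rfl

theorem exists_eq_gram_of_posSemidef [Finite ι] {A : Matrix ι ι ℂ} (hA : A.PosSemidef) :
    ∃ (n : ℕ) (v : ι → EuclideanSpace ℂ (Fin n)), A = gram ℂ v := by
  obtain ⟨n, u, rfl⟩ := Matrix.posSemidef_iff_eq_sum_vecMulVec.1 hA
  refine ⟨n, fun i => WithLp.toLp 2 fun j => star (u j i), ?_⟩
  ext i j
  simp [Matrix.sum_apply, vecMulVec_apply, PiLp.inner_apply, mul_comm]

theorem posSemidef_of_finset {A : Matrix ι ι ℂ}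
    (h : ∀ S : Finset ι, (A.submatrix ((↑) : S → ι) (↑)).PosSemidef) : A.PosSemidef := by
  classical
  refine ⟨?_, fun x => ?_⟩
  · ext i j
    simpa using (h {i, j}).isHermitian.apply ⟨i, by simp⟩ ⟨j, by simp⟩
  · simpa [Finsupp.sum, ← Finset.sum_attach x.support, ← Finset.subtype_mem_eq_attach,
      ← Finsupp.subtypeDomain_apply, ← Finsupp.support_subtypeDomain] using
      (h x.support).2 (x.subtypeDomain _)

/-- Bordering a positive semidefinite matrix by zeros keeps it positive semidefinite. -/
theorem posSemidef_insert_of_eq_zero [DecidableEq ι] {A : Matrix ι ι ℂ} {S : Finset ι} {a : ι}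
    (hrow : ∀ i, A a i = 0) (hcol : ∀ i, A i a = 0)
    (hA : (A.submatrix ((↑) : S → ι) (↑)).PosSemidef) :
    (A.submatrix ((↑) : ↥(insert a S) → ι) (↑)).PosSemidef := by
  obtain ⟨n, v, hv⟩ := exists_eq_gram_of_posSemidef hA
  have hv' : ∀ (i j : ι) (hi : i ∈ S) (hj : j ∈ S), A i j = ⟪v ⟨i, hi⟩, v ⟨j, hj⟩⟫_ℂ :=
    fun i j hi hj => congr_fun (congr_fun hv ⟨i, hi⟩) ⟨j, hj⟩
  convert posSemidef_gram_infinite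
    (fun i : ↥(insert a S) => if h : (i : ι) ∈ S then v ⟨i, h⟩ else 0)
  ext i j
  simp only [submatrix_apply, gram_apply]
  by_cases hi : (i : ι) ∈ S
  · by_cases hj : (j : ι) ∈ S
    · simp [hi, hj, hv']
    · have : (j : ι) = a := (Finset.mem_insert.1 j.2).resolve_right hj
      rw [dif_neg hj, inner_zero_right, this, hcol]
  · have : (i : ι) = a := (Finset.mem_insert.1 i.2).resolve_right hi
    rw [dif_neg hi, inner_zero_left, this, hrow]

end GramMatrices

/-! ### Kernel functions -/

section KernelFunctions

variable {X F E : Type*} [NormedAddCommGroup F] [InnerProductSpace ℂ F] [CompleteSpace F]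
  [NormedAddCommGroup E] [InnerProductSpace ℂ E] [CompleteSpace E]

theorem ScalarKernel.posSemidef_of (k : ScalarKernel X) : (Matrix.of k.toFun).PosSemidef :=
  posSemidef_of_finset k.posSemidef

theorem ScalarKernel.inner_kerFun_kerFun (k : ScalarKernel X) (x y : X) (v w : E) :
    ⟪RKHS.kerFun (HTensor k E) x v, RKHS.kerFun (HTensor k E) y w⟫_ℂ = k x y * ⟪v, w⟫_ℂ := by
  rw [← RKHS.kernel_inner, RKHS.OfKernel.kernel_ofKernel]
  simp only [ScalarKernel.ampliation, Matrix.of_apply, _root_.smul_apply,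
    ContinuousLinearMap.id_apply, inner_smul_left]
  rw [← k.conj_apply x y]
  rfl

/-- The adjoint of a multiplication operator maps kernel functions to kernel functions. -/
theorem IsMultiplier.adjoint_mulOp_kerFun {l k : ScalarKernel X} {Φ : X → F →L[ℂ] E}
    (h : IsMultiplier l k Φ) (x : X) (e : E) :
    (h.mulOp).adjoint (RKHS.kerFun (HTensor k E) x e) =
      RKHS.kerFun (HTensor l F) x ((Φ x).adjoint e) := by
  refine ext_inner_right ℂ fun f => ?_
  rw [ContinuousLinearMap.adjoint_inner_left, RKHS.kerFun_inner, RKHS.kerFun_inner,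
    h.mulOp_apply, ContinuousLinearMap.adjoint_inner_left]

end KernelFunctions

/-! ### The kernel `1 - 1 / s` of a complete Nevanlinna–Pick kernel -/

section NevanlinnaPick

variable {X : Type*} {s : ScalarKernel X}

/-- Scalar form of the complete Nevanlinna–Pick property for row-valued data, with the data given
through its Gram matrix `G`: the Pick matrix stays positive semidefinite when the kernel `s` is
replaced by the kernel of the subspace of functions vanishing at `y`. -/
theorem ScalarKernel.IsCompleteNevanlinnaPick.posSemidef_pick_vanishing
    (hs : s.IsCompleteNevanlinnaPick) {S : Finset X} {G : Matrix S S ℂ} (hG : G.PosSemidef)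
    (hP : (Matrix.of fun z w : S => s z w * (1 - G z w)).PosSemidef) {y : X} (hy : s y y ≠ 0) :
    (Matrix.of fun z w : S => (s z w - s z y * s y w / s y y) * (1 - G z w)).PosSemidef := by
  obtain ⟨n, v, rfl⟩ := exists_eq_gram_of_posSemidef hG
  set e : EuclideanSpace ℂ (Fin 1) := EuclideanSpace.single 0 1 with he
  have hee : ⟪e, e⟫_ℂ = 1 := by simp [he]
  have hrep : ∀ u : EuclideanSpace ℂ (Fin 1), ⟪e, u⟫_ℂ • e = u := fun u => by
    ext i
    fin_cases i
    simp [he, EuclideanSpace.inner_single_left]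
  let W : S → EuclideanSpace ℂ (Fin n) →L[ℂ] EuclideanSpace ℂ (Fin 1) :=
    fun z => (innerSL ℂ (v z)).smulRight e
  have hW : ∀ z (u : EuclideanSpace ℂ (Fin 1)), (W z).adjoint u = ⟪e, u⟫_ℂ • v z := fun z u => by
    refine ext_inner_right ℂ fun f => ?_
    rw [ContinuousLinearMap.adjoint_inner_left]
    simp [W, inner_smul_left, inner_smul_right, mul_comm]
  let p : ScalarKernel S := ⟨fun z w => s z w * (1 - gram ℂ v z w), fun T => hP.submatrix _⟩
  obtain ⟨Φ, ⟨hΦ, hΦ1⟩, hΦW⟩ := hs 1 n S W (by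
    convert p.posSemidef_ampliation (EuclideanSpace ℂ (Fin 1)) using 1
    ext z w u : 3
    have hWW : W z (⟪e, u⟫_ℂ • v w) = ⟪v z, v w⟫_ℂ • u := by
      simp only [W, map_smul, ContinuousLinearMap.smulRight_apply, innerSL_apply_apply]
      rw [smul_comm, hrep]
    simp only [of_apply, ScalarKernel.ampliation, p, _root_.smul_apply,
      _root_.sub_apply, ContinuousLinearMap.id_apply, ContinuousLinearMap.comp_apply,
      hW, hWW, mul_smul, sub_smul, one_smul, gram_apply])
  set c : S → ℂ := fun z => s y z / s y y with hc
  set w : X → EuclideanSpace ℂ (Fin n) := fun x => (Φ x).adjoint e with hw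
  have hwv : ∀ z : S, w z = v z := fun z => by rw [hw]; simp only [hΦW, hW, hee, one_smul]
  -- The projections of the kernel functions to the functions vanishing at `y`.
  let a : S → HTensor s (EuclideanSpace ℂ (Fin 1)) := fun z =>
    RKHS.kerFun (HTensor s _) (z : X) e - c z • RKHS.kerFun (HTensor s _) y e
  have hT : ‖(hΦ.mulOp).adjoint‖ ≤ 1 := by
    rw [LinearIsometryEquiv.norm_map]; exact hΦ1
  have h1 := posSemidef_gram_sub_gram_of_contraction a hT
  have hyy : star (s y y) = s y y := s.conj_apply y y
  have hpos : 0 ≤ s y y := s.posSemidef_of.diag_nonneg (i := y)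
  -- The compressed Pick matrix falls short of the target by a term coming from `w y`, which is
  -- itself positive semidefinite.
  have h2 := ((posSemidef_gram_infinite c).hadamard
    (posSemidef_gram_infinite fun z : S => w z - w y)).smul hpos
  convert h1.add h2 using 1
  ext z z'
  have hTa : ∀ z, (hΦ.mulOp).adjoint (a z) =
      RKHS.kerFun (HTensor s _) (z : X) (w z) - c z • RKHS.kerFun (HTensor s _) y (w y) :=
    fun z => by simp only [a, map_sub, map_smul, hΦ.adjoint_mulOp_kerFun, hw]
  have hcz : starRingEnd ℂ (c z) = s z y / s y y := by
    have := s.conj_apply z y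
    simp only [RCLike.star_def] at this hyy
    rw [hc]; simp only [map_div₀, this, hyy]
  simp only [of_apply, Matrix.add_apply, Matrix.sub_apply, Matrix.smul_apply, hadamard_apply,
    gram_apply, hTa, smul_eq_mul]
  simp only [a, inner_sub_left, inner_sub_right, inner_smul_left, inner_smul_right,
    s.inner_kerFun_kerFun, hcz, hwv, hee, RCLike.inner_apply]
  simp only [hc]
  field_simp
  ring

/-- The Nevanlinna–Pick property rules out zeros of a normalized kernel: two distinct, orthogonal
kernel functions would allow the Pick matrix of a `±1`-valued interpolation problem to vanish. -/
theorem ScalarKernel.IsCompleteNevanlinnaPick.ne_zero (hs : s.IsCompleteNevanlinnaPick)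
    {x₀ : X} (hx₀ : ∀ x, s x x₀ = 1) (x y : X) : s x y ≠ 0 := by
  classical
  intro hxy
  have hx₀' : ∀ x, s x₀ x = 1 := fun x => by rw [← s.conj_apply, hx₀, star_one]
  have hyx : s y x = 0 := by rw [← s.conj_apply, hxy, star_zero]
  have h00 : s x₀ x₀ ≠ 0 := by simp [hx₀]
  by_cases hne : x = y
  · subst hne
    have h := hs.posSemidef_pick_vanishing (S := {x}) (G := 0) Matrix.PosSemidef.zero
      (by simpa using! s.posSemidef {x}) h00
    have h1 := h.diag_nonneg (i := ⟨x, by simp⟩)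
    simp [hx₀, hx₀', hxy] at h1
    norm_num [Complex.le_def] at h1
  · let v : ({x, y} : Finset X) → ℂ := fun z => if (z : X) = x then 1 else -1
    have h := hs.posSemidef_pick_vanishing (S := {x, y}) (posSemidef_gram_infinite v) (by
      convert Matrix.PosSemidef.zero
      ext ⟨z, hz⟩ ⟨w, hw⟩
      simp only [Finset.mem_insert, Finset.mem_singleton] at hz hw
      rcases hz with rfl | rfl <;> rcases hw with rfl | rfl <;>
        simp [v, hxy, hyx, Ne.symm hne]) h00
    have h1 := (h.submatrix ![⟨x, by simp⟩, ⟨y, by simp⟩]).dotProduct_mulVec_nonneg 1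
    simp [dotProduct, mulVec, Fin.sum_univ_two, hx₀, hx₀', hxy, hyx, v, Ne.symm hne] at h1
    norm_num [Complex.le_def] at h1

/-- McCullough–Quiggin theorem, at an arbitrary base point. The induction adds the points one at a
time: the statement for the smaller set, with the new point as base point, is exactly what makes
`1 - s(z, a) s(a, w) / (s(z, w) s(a, a))` admissible as the Gram matrix of row-valued
interpolation data, whose Pick matrix then has rank one. -/
theorem ScalarKernel.IsCompleteNevanlinnaPick.posSemidef_one_sub_div
    (hs : s.IsCompleteNevanlinnaPick) (hne : ∀ x y, s x y ≠ 0) (S : Finset X) (y : X) :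
    ((Matrix.of fun z w : X => 1 - s z y * s y w / (s z w * s y y)).submatrix
      ((↑) : S → X) (↑)).PosSemidef := by
  classical
  induction S using Finset.induction_on generalizing y with
  | empty =>
    convert Matrix.PosSemidef.zero
    ext z
    exact absurd z.2 (Finset.notMem_empty _)
  | insert a S ha ih =>
    have hG := posSemidef_insert_of_eq_zero
      (A := Matrix.of fun z w : X => 1 - s z a * s a w / (s z w * s a a))
      (fun z => by simp only [of_apply]; field_simp [hne]; simp)
      (fun z => by simp only [of_apply]; field_simp [hne]; simp) (ih a)
    have hstar : ∀ z w, star (s z w) = s w z := fun z w => s.conj_apply w z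
    have hpos : ∀ z, 0 ≤ s z z := fun z => s.posSemidef_of.diag_nonneg (i := z)
    have hrank : ∀ u : ↥(insert a S) → ℂ, (Matrix.of fun z w => star (u z) * u w).PosSemidef :=
      fun u => by
        convert posSemidef_gram_infinite u using 1
        ext z w
        simp [mul_comm]
    have h1 := hs.posSemidef_pick_vanishing hG (by
      convert (hrank fun z => s a z).smul (inv_nonneg.2 (hpos a)) using 1
      ext z w
      simp only [of_apply, submatrix_apply, Matrix.smul_apply, smul_eq_mul, hstar]
      have := hne z w
      have := hne a a
      field_simp
      ring) (hne y y)
    have h2 := ((hrank fun z => (s a z)⁻¹).hadamard h1).smul (hpos a)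
    refine (congrArg Matrix.PosSemidef (Matrix.ext fun z w => ?_)).mpr h2
    simp only [of_apply, submatrix_apply, Matrix.smul_apply, smul_eq_mul, hadamard_apply, star_inv₀,
      hstar]
    have := hne z w
    have := hne a a
    have := hne y y
    have := hne z a
    have := hne a w
    field_simp
    ring

/-- The kernel `1 - 1 / s`. It exists for a complete Nevanlinna–Pick kernel `s` normalized at
`x₀`. -/
noncomputable def ScalarKernel.IsCompleteNevanlinnaPick.oneSubInv (hs : s.IsCompleteNevanlinnaPick)
    {x₀ : X} (hx₀ : ∀ x, s x x₀ = 1) : ScalarKernel X where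
  toFun x y := 1 - (s x y)⁻¹
  posSemidef S := by
    have h := hs.posSemidef_one_sub_div (hs.ne_zero hx₀) S x₀
    have hx₀' : ∀ x, s x₀ x = 1 := fun x => by rw [← s.conj_apply, hx₀, star_one]
    simpa [hx₀, hx₀'] using! h

end NevanlinnaPick

/-! ### Kernels of contractively contained ranges -/

section Domination

/-- A partial isometry attains each of its values at a vector of the same norm as the value, which
is the shortest solution. -/
theorem exists_preimage_of_partialIsometry {H H' : Type*} [NormedAddCommGroup H]
    [InnerProductSpace ℂ H] [CompleteSpace H] [NormedAddCommGroup H'] [InnerProductSpace ℂ H']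
    {T : H →L[ℂ] H'} (hT : ∀ f ∈ (LinearMap.ker T.toLinearMap)ᗮ, ‖T f‖ = ‖f‖) (f : H) :
    ∃ r, T r = T f ∧ ‖r‖ = ‖T f‖ ∧ ‖r‖ ≤ ‖f‖ := by
  set K := LinearMap.ker T.toLinearMap
  have hK : IsClosed (K : Set H) := T.isClosed_ker
  have : CompleteSpace K := hK.completeSpace_coe
  have hr : T (Kᗮ.starProjection f) = T f := by
    have h1 : f - Kᗮ.starProjection f ∈ K := by
      have := Kᗮ.sub_starProjection_mem_orthogonal f
      rwa [Submodule.orthogonal_orthogonal] at this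
    have h2 : T (f - Kᗮ.starProjection f) = 0 := h1
    rw [map_sub, sub_eq_zero] at h2
    exact h2.symm
  refine ⟨Kᗮ.starProjection f, hr, ?_, Kᗮ.norm_starProjection_apply_le f⟩
  rw [← hr, hT _ (Kᗮ.starProjection_apply_mem f)]

variable {X F G E : Type*} [NormedAddCommGroup F] [InnerProductSpace ℂ F] [CompleteSpace F]
  [NormedAddCommGroup G] [InnerProductSpace ℂ G] [CompleteSpace G]
  [NormedAddCommGroup E] [InnerProductSpace ℂ E] [CompleteSpace E]

/-- Contractive containment of the ranges of two partially isometric multipliers, expressed by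
kernels: `s(x, y) (Φ(x) Φ(y)^* - Ψ(x) Ψ(y)^*)` is positive semidefinite. -/
theorem posSemidef_gram_sub_gram_of_isContractivelyContained {k l s : ScalarKernel X}
    {M : Submodule ℂ (HTensor k E)} {N : Submodule ℂ (HTensor l E)}
    (hNM : IsContractivelyContained N M)
    {Φ : X → F →L[ℂ] E} (hΦ : IsPartiallyIsometricMultiplier s k Φ)
    {Ψ : X → G →L[ℂ] E} (hΨ : IsPartiallyIsometricMultiplier s l Ψ)
    (hM : (M : Set (HTensor k E)) = mulImage s k Φ)
    (hN : (N : Set (HTensor l E)) = mulImage s l Ψ) :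
    (gram ℂ (fun p : X × E => RKHS.kerFun (HTensor s F) p.1 ((Φ p.1).adjoint p.2)) -
      gram ℂ (fun p : X × E =>
        RKHS.kerFun (HTensor s G) p.1 ((Ψ p.1).adjoint p.2))).PosSemidef := by
  obtain ⟨hΦm, hΦi⟩ := hΦ
  obtain ⟨hΨm, hΨi⟩ := hΨ
  refine posSemidef_gram_sub_gram_of_norm_le fun c => ?_
  set a : HTensor k E :=
    Finsupp.linearCombination ℂ (fun p : X × E => RKHS.kerFun (HTensor k E) p.1 p.2) c with ha
  set b : HTensor l E :=
    Finsupp.linearCombination ℂ (fun p : X × E => RKHS.kerFun (HTensor l E) p.1 p.2) c with hb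
  have hab : ∀ (g : HTensor k E) (f : HTensor l E), (∀ x, g x = f x) → ⟪a, g⟫_ℂ = ⟪b, f⟫_ℂ := by
    intro g f hgf
    simp only [ha, hb, Finsupp.linearCombination_apply, Finsupp.sum_inner, inner_smul_left,
      RKHS.kerFun_inner, hgf]
  have hp : Finsupp.linearCombination ℂ
      (fun p : X × E => RKHS.kerFun (HTensor s F) p.1 ((Φ p.1).adjoint p.2)) c =
      (hΦm.mulOp).adjoint a := by
    simp only [ha, Finsupp.linearCombination_apply, map_finsuppSum, map_smul,
      hΦm.adjoint_mulOp_kerFun]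
  have hq : Finsupp.linearCombination ℂ
      (fun p : X × E => RKHS.kerFun (HTensor s G) p.1 ((Ψ p.1).adjoint p.2)) c =
      (hΨm.mulOp).adjoint b := by
    simp only [hb, Finsupp.linearCombination_apply, map_finsuppSum, map_smul,
      hΨm.adjoint_mulOp_kerFun]
  rw [hp, hq]
  set p := (hΦm.mulOp).adjoint a
  set q := (hΨm.mulOp).adjoint b with hq'
  obtain ⟨q', -, hq1, hq2⟩ := exists_preimage_of_partialIsometry hΨi q
  have hmem : hΨm.mulOp q ∈ N := by
    rw [← SetLike.mem_coe, hN]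
    exact ⟨q, hΨm.mulOp_apply q⟩
  obtain ⟨g, hgM, hg, hgn⟩ := hNM _ hmem
  rw [← SetLike.mem_coe, hM] at hgM
  obtain ⟨f, hf⟩ := hgM
  have hgf : hΦm.mulOp f = g := by
    ext x
    rw [hΦm.mulOp_apply, hf]
  obtain ⟨r, hr1, hr2, -⟩ := exists_preimage_of_partialIsometry hΦi f
  -- `q` and `r` multiply to the same function, which is paired with the same point evaluations
  -- in the two function spaces.
  have hinner : ⟪q, q⟫_ℂ = ⟪p, r⟫_ℂ := by
    conv_lhs => rw [hq']
    rw [ContinuousLinearMap.adjoint_inner_left, ← hab g _ hg, ← hgf, ← hr1,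
      ContinuousLinearMap.adjoint_inner_left]
  have hrq : ‖r‖ ≤ ‖q‖ := by
    rw [hr2, hgf]
    exact hgn.trans (hq1 ▸ hq2)
  have h1 : ‖q‖ * ‖q‖ ≤ ‖p‖ * ‖q‖ := by
    rw [← inner_self_eq_norm_mul_norm (𝕜 := ℂ), hinner]
    exact (re_inner_le_norm p r).trans (by gcongr)
  rcases (norm_nonneg q).eq_or_lt with h0 | h0
  · rw [← h0]; exact norm_nonneg p
  · exact le_of_mul_le_mul_right h1 h0

end Domination

/-! ### Factorization of multipliers -/

section Leech

variable {X F G E : Type*} [NormedAddCommGroup F] [InnerProductSpace ℂ F] [CompleteSpace F]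
  [NormedAddCommGroup G] [InnerProductSpace ℂ G] [CompleteSpace G]
  [NormedAddCommGroup E] [InnerProductSpace ℂ E] [CompleteSpace E]

/-- An operator-valued kernel is positive semidefinite as soon as the scalar matrix of its
sesquilinear forms is. -/
theorem posSemidef_of_inner_eq {K : Matrix X X (E →L[ℂ] E)} {A : Matrix (X × E) (X × E) ℂ}
    (hA : A.PosSemidef) (h : ∀ x y v w, ⟪K y x v, w⟫_ℂ = A (x, v) (y, w)) : K.PosSemidef := by
  have htfae := (RKHS.posSemidef_tfae (K := K)).out 0 1
  refine htfae.mpr ⟨?_, fun c => ?_⟩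
  · ext1 x y
    refine ContinuousLinearMap.ext fun v => ext_inner_right ℂ fun w => ?_
    rw [conjTranspose_apply, ContinuousLinearMap.star_eq_adjoint,
      ContinuousLinearMap.adjoint_inner_left, ← inner_conj_symm, h, h]
    exact hA.isHermitian.apply _ _
  · have h1 := hA.2 c
    simp only [h]
    refine (RCLike.nonneg_iff.1 h1).1.trans_eq (congrArg _ ?_)
    refine Finsupp.sum_congr fun i _ => Finsupp.sum_congr fun j _ => ?_
    simp only [RCLike.star_def]
    ring

/-- A `B(G, F)`-valued function `Γ` with `s(x, y) (1 - Γ(x) Γ(y)^*)` positive semidefinite is a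
contractive multiplier: the multiplication operator is constructed as an adjoint. -/
theorem isContractiveMultiplier_of_posSemidef {s : ScalarKernel X} {Γ : X → G →L[ℂ] F}
    (h : (gram ℂ (fun p : X × F => RKHS.kerFun (HTensor s F) p.1 p.2) -
      gram ℂ (fun p : X × F =>
        RKHS.kerFun (HTensor s G) p.1 ((Γ p.1).adjoint p.2))).PosSemidef) :
    IsContractiveMultiplier s s Γ := by
  obtain ⟨T, hT, hTk⟩ := exists_contraction_of_gram_le h
  have hT' : ∀ (g : HTensor s G) (x : X), T.adjoint g x = Γ x (g x) := fun g x => by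
    refine ext_inner_right ℂ fun f => ?_
    rw [← RKHS.inner_kerFun, ContinuousLinearMap.adjoint_inner_left, hTk (x, f),
      RKHS.inner_kerFun, ContinuousLinearMap.adjoint_inner_right]
  have hm : IsMultiplier s s Γ := fun g => ⟨T.adjoint g, hT' g⟩
  have hop : hm.mulOp = T.adjoint := by
    ext g x
    rw [hm.mulOp_apply, hT']
  refine ⟨hm, ?_⟩
  rw [hop, LinearIsometryEquiv.norm_map]
  exact hT

/-- The kernel functions of `t = 1 - 1 / s` lie in the open unit ball, so that the transfer
function resolvent below exists. -/
theorem norm_kerFun_lt_one {s t : ScalarKernel X} (hs : ∀ x y, s x y ≠ 0)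
    (ht : ∀ x y, t x y = 1 - (s x y)⁻¹) (x : X) :
    ‖RKHS.kerFun (HTensor t E) x‖ < 1 := by
  have h0 : 0 ≤ t x x := t.posSemidef_of.diag_nonneg (i := x)
  have h1 : 0 < (s x x)⁻¹ :=
    inv_pos.2 (lt_of_le_of_ne (s.posSemidef_of.diag_nonneg (i := x)) (hs x x).symm)
  have h2 : t x x < 1 := by rw [ht]; exact sub_lt_self _ h1
  have h3 : ‖t x x‖ < 1 := by
    have := (Complex.norm_of_nonneg' h0).symm ▸ h2
    exact_mod_cast this
  have h4 : ‖RKHS.kerFun (HTensor t E) x‖ ^ 2 < 1 := by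
    rw [← RKHS.norm_kernel_eq_norm_kerFun_sq, RKHS.OfKernel.kernel_ofKernel]
    refine lt_of_le_of_lt ?_ h3
    simp only [ScalarKernel.ampliation, of_apply, norm_smul]
    exact mul_le_of_le_one_right (norm_nonneg _) ContinuousLinearMap.norm_id_le
  exact (sq_lt_one_iff₀ (norm_nonneg _)).1 h4

/-- Leech's factorization theorem for a kernel `s` for which `t = 1 - 1 / s` is again a kernel,
by the lurking isometry argument. Writing `s (Φ Φ^* - Ψ Ψ^*) = L L^*`, the identity
`Φ Φ^* + t L L^* = Ψ Ψ^* + L L^*` defines an isometry, and `Γ^*` is the transfer function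
of a contractive extension of it. -/
theorem exists_contractiveMultiplier_factor {s t : ScalarKernel X} (hs : ∀ x y, s x y ≠ 0)
    (ht : ∀ x y, t x y = 1 - (s x y)⁻¹) {Φ : X → F →L[ℂ] E} {Ψ : X → G →L[ℂ] E}
    (h : (gram ℂ (fun p : X × E => RKHS.kerFun (HTensor s F) p.1 ((Φ p.1).adjoint p.2)) -
      gram ℂ (fun p : X × E =>
        RKHS.kerFun (HTensor s G) p.1 ((Ψ p.1).adjoint p.2))).PosSemidef) :
    ∃ Γ : X → G →L[ℂ] F, IsContractiveMultiplier s s Γ ∧ ∀ x, Ψ x = Φ x ∘L Γ x := by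
  let K : Matrix X X (E →L[ℂ] E) := Matrix.of fun x y =>
    s x y • (Φ x ∘L (Φ y).adjoint - Ψ x ∘L (Ψ y).adjoint)
  have hK : ∀ x y v w, ⟪K y x v, w⟫_ℂ =
      s x y * (⟪(Φ x).adjoint v, (Φ y).adjoint w⟫_ℂ - ⟪(Ψ x).adjoint v, (Ψ y).adjoint w⟫_ℂ) := by
    intro x y v w
    have := s.conj_apply x y
    simp only [RCLike.star_def] at this
    simp only [K, of_apply, _root_.smul_apply, _root_.sub_apply,
      ContinuousLinearMap.comp_apply, inner_smul_left, inner_sub_left, this,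
      ContinuousLinearMap.adjoint_inner_right]
  have : Fact K.PosSemidef := ⟨posSemidef_of_inner_eq h fun x y v w => by
    rw [hK, Matrix.sub_apply, gram_apply, gram_apply, s.inner_kerFun_kerFun,
      s.inner_kerFun_kerFun, mul_sub]⟩
  let L := RKHS.OfKernel K
  let L' : X → E →L[ℂ] L := fun x => RKHS.kerFun L x
  have hL' : ∀ x y v w, ⟪L' x v, L' y w⟫_ℂ =
      s x y * (⟪(Φ x).adjoint v, (Φ y).adjoint w⟫_ℂ - ⟪(Ψ x).adjoint v, (Ψ y).adjoint w⟫_ℂ) := by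
    intro x y v w
    rw [← RKHS.kernel_inner, RKHS.OfKernel.kernel_ofKernel, hK]
  let B : X → L →L[ℂ] HTensor t L := fun x => RKHS.kerFun (HTensor t L) x
  have hB : ∀ x y u v, ⟪B x u, B y v⟫_ℂ = (1 - (s x y)⁻¹) * ⟪u, v⟫_ℂ := fun x y u v => by
    rw [t.inner_kerFun_kerFun, ht]
  obtain ⟨V, hV, hVe⟩ := exists_contraction_of_gram_le
    (v := fun p : X × E =>
      (WithLp.toLp 2 ((Φ p.1).adjoint p.2, B p.1 (L' p.1 p.2)) : WithLp 2 (F × HTensor t L)))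
    (w := fun p : X × E =>
      (WithLp.toLp 2 ((Ψ p.1).adjoint p.2, L' p.1 p.2) : WithLp 2 (G × L))) (by
    convert Matrix.PosSemidef.zero
    ext ⟨x, v⟩ ⟨y, w⟩
    have := hs x y
    simp only [Matrix.sub_apply, gram_apply, WithLp.prod_inner_apply, hB, hL', Matrix.zero_apply]
    field_simp
    ring)
  -- The block entries of the contraction.
  let j := (WithLp.prodContinuousLinearEquiv 2 ℂ F (HTensor t L)).symm.toContinuousLinearMap
  let A₁ : F →L[ℂ] G := WithLp.fstL 2 ℂ G L ∘L V ∘L j ∘L ContinuousLinearMap.inl ℂ F (HTensor t L)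
  let A₂ : HTensor t L →L[ℂ] G :=
    WithLp.fstL 2 ℂ G L ∘L V ∘L j ∘L ContinuousLinearMap.inr ℂ F (HTensor t L)
  let C₁ : F →L[ℂ] L := WithLp.sndL 2 ℂ G L ∘L V ∘L j ∘L ContinuousLinearMap.inl ℂ F (HTensor t L)
  let C₂ : HTensor t L →L[ℂ] L :=
    WithLp.sndL 2 ℂ G L ∘L V ∘L j ∘L ContinuousLinearMap.inr ℂ F (HTensor t L)
  have hVblock : ∀ (f : F) (u : HTensor t L),
      V (WithLp.toLp 2 (f, u)) = WithLp.toLp 2 (A₁ f + A₂ u, C₁ f + C₂ u) := by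
    intro f u
    have h1 : (WithLp.toLp 2 (f, u) : WithLp 2 (F × HTensor t L)) = j (f, 0) + j (0, u) := by
      rw [← map_add, Prod.mk_add_mk, add_zero, zero_add]; rfl
    rw [h1, map_add]
    rfl
  have hC₂ : ‖C₂‖ ≤ 1 := by
    refine ContinuousLinearMap.opNorm_le_bound _ zero_le_one fun u => ?_
    calc ‖C₂ u‖ ≤ ‖V (WithLp.toLp 2 (0, u))‖ := WithLp.norm_snd_le _ _
      _ ≤ 1 * ‖(WithLp.toLp 2 (0, u) : WithLp 2 (F × HTensor t L))‖ := V.le_of_opNorm_le hV _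
      _ = 1 * ‖u‖ := by rw [WithLp.norm_toLp_snd]
  have hunit : ∀ x, IsUnit (1 - C₂ ∘L B x : L →L[ℂ] L) := fun x => by
    refine isUnit_one_sub_of_norm_lt_one ?_
    calc ‖C₂ ∘L B x‖ ≤ ‖C₂‖ * ‖B x‖ := ContinuousLinearMap.opNorm_comp_le _ _
      _ ≤ 1 * ‖B x‖ := by gcongr
      _ < 1 := by rw [one_mul]; exact norm_kerFun_lt_one hs ht x
  choose R hR using fun x => (hunit x).exists_left_inv
  choose R' hR' using fun x => (hunit x).exists_right_inv
  have hRR : ∀ x, R x = R' x := fun x => left_inv_eq_right_inv (hR x) (hR' x)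
  -- The state vectors of the transfer function: `T x = (1 - C₂ B(x))⁻¹ C₁`.
  let T : X → F →L[ℂ] L := fun x => R x ∘L C₁
  have hT : ∀ x f, C₁ f + C₂ (B x (T x f)) = T x f := fun x f => by
    have := congrArg (fun Q : L →L[ℂ] L => Q (C₁ f)) (hR' x)
    rw [← hRR] at this
    exact (sub_eq_iff_eq_add.1 this).symm
  have hTL : ∀ x e, T x ((Φ x).adjoint e) = L' x e := fun x e => by
    have h1 := congrArg (fun z : WithLp 2 (G × L) => z.snd) ((hVblock _ _).symm.trans (hVe (x, e)))
    have h2 : C₁ ((Φ x).adjoint e) = L' x e - C₂ (B x (L' x e)) := eq_sub_of_add_eq h1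
    have h3 := congrArg (fun Q : L →L[ℂ] L => Q (L' x e)) (hR x)
    simp only [T, ContinuousLinearMap.comp_apply, h2]
    exact h3
  refine ⟨fun x => (A₁ + A₂ ∘L B x ∘L T x).adjoint, isContractiveMultiplier_of_posSemidef ?_,
    fun x => ?_⟩
  · simp only [ContinuousLinearMap.adjoint_adjoint]
    let P : X × F → WithLp 2 (F × HTensor t L) := fun p =>
      WithLp.toLp 2 (p.2, B p.1 (T p.1 p.2))
    have hVP : ∀ p, V (P p) =
        WithLp.toLp 2 ((A₁ + A₂ ∘L B p.1 ∘L T p.1) p.2, T p.1 p.2) := fun p => by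
      rw [hVblock, hT]; rfl
    -- The defect of `Γ` is the product of `s` with the defect of `V`, plus a Gram matrix.
    have h1 := ((s.posSemidef_of.submatrix (Prod.fst : X × F → X)).hadamard
      (posSemidef_gram_sub_gram_of_contraction P hV)).add
      (posSemidef_gram_infinite fun p : X × F => T p.1 p.2)
    refine (congrArg Matrix.PosSemidef (Matrix.ext fun ⟨x, f⟩ ⟨y, g⟩ => ?_)).mpr h1
    have := hs x y
    simp only [Matrix.sub_apply, Matrix.add_apply, hadamard_apply, submatrix_apply, of_apply,
      gram_apply, s.inner_kerFun_kerFun, hVP]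
    simp only [P, WithLp.prod_inner_apply, hB]
    field_simp
    ring
  · have hadj : (Ψ x).adjoint = (A₁ + A₂ ∘L B x ∘L T x) ∘L (Φ x).adjoint := by
      ext e
      have h1 := congrArg (fun z : WithLp 2 (G × L) => z.fst)
        ((hVblock _ _).symm.trans (hVe (x, e)))
      simp only [ContinuousLinearMap.comp_apply, _root_.add_apply, hTL]
      exact h1.symm
    rw [← ContinuousLinearMap.adjoint_adjoint (Ψ x), hadj, ContinuousLinearMap.adjoint_comp,
      ContinuousLinearMap.adjoint_adjoint]

end Leech

end BeurlingLaxHalmos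

theorem theorem2p4 {X : Type*} (k l s : BeurlingLaxHalmos.ScalarKernel X)
    (hs_norm : s.IsNormalized) (hs_cnp : s.IsCompleteNevanlinnaPick)
    {E F G : Type*}
    [NormedAddCommGroup E] [InnerProductSpace ℂ E] [CompleteSpace E]
    [NormedAddCommGroup F] [InnerProductSpace ℂ F] [CompleteSpace F]
    [NormedAddCommGroup G] [InnerProductSpace ℂ G] [CompleteSpace G]
    (M : Submodule ℂ (BeurlingLaxHalmos.HTensor k E))
    (N : Submodule ℂ (BeurlingLaxHalmos.HTensor l E))
    (hM_closed : IsClosed (M : Set (BeurlingLaxHalmos.HTensor k E))) (hM_ne : M ≠ ⊥)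
    (hN_closed : IsClosed (N : Set (BeurlingLaxHalmos.HTensor l E))) (hN_ne : N ≠ ⊥)
    (hNM : BeurlingLaxHalmos.IsContractivelyContained N M)
    (Φ : X → F →L[ℂ] E) (hΦ : BeurlingLaxHalmos.IsPartiallyIsometricMultiplier s k Φ)
    (Ψ : X → G →L[ℂ] E) (hΨ : BeurlingLaxHalmos.IsPartiallyIsometricMultiplier s l Ψ)
    (hM : (M : Set (BeurlingLaxHalmos.HTensor k E)) = BeurlingLaxHalmos.mulImage s k Φ)
    (hN : (N : Set (BeurlingLaxHalmos.HTensor l E)) = BeurlingLaxHalmos.mulImage s l Ψ) :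
    ∃ Γ : X → G →L[ℂ] F, BeurlingLaxHalmos.IsContractiveMultiplier s s Γ ∧
      ∀ x, Ψ x = Φ x ∘L Γ x := by
  obtain ⟨x₀, hx₀⟩ := hs_norm
  exact BeurlingLaxHalmos.exists_contractiveMultiplier_factor (t := hs_cnp.oneSubInv hx₀)
    (hs_cnp.ne_zero hx₀) (fun _ _ => rfl)
    (BeurlingLaxHalmos.posSemidef_gram_sub_gram_of_isContractivelyContained hNM hΦ hΨ hM hN)
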